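/- Let $T$ be a set of types containing two distinct types $\alpha\neq\beta$. An oriented multi-virtual link diagram is a planar oriented link diagram with classical crossings and with virtual crossings, each labelled by a type from $T$. Two such diagrams are equivalent if they are related by finitely many planar isotopies, classical Reidemeister moves and multi-virtual detour moves (a strand meeting $m$ strands in virtual crossings of one type $t$ is moved across an arbitrary $m,n$-tangle, then meeting the $n$ strands on the other side in virtual crossings of the same type $t$; loops with a virtual crossing of any type may be added to or removed from a strand). A multi-virtual link is an equivalence class of diagrams; it is a knot if it has a diagram with exactly one component. Its classical crossing number $\mathrm{cr}_c$ is the least number of classical crossings in any of its diagrams. For a quandle $(Q,*)$ (with right translations as automorphisms) and pairwise commuting automorphisms $A=(A_t)_{t\in T}$ of it, $\mathrm{Col}(D,Q,*,A)$ is the number of ways to assign elements of $Q$ to the arcs of $D$ so that: at a classical crossing the overpass keeps its color $o$, and if the underpass has color $c$ to the right of the oriented overpass, it has color $c*o$ to its left; at a virtual crossing of type $t$ a strand of color $c$ gets the color $A_t(c)$ after crossing a strand that passes from its left to its right, and $A_t^{-1}(c)$ after crossing a strand that passes from its right to its left. Let $K(n)$ be the closure of the two-strand diagram, with both strands oriented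 in the same direction, consisting of $2n$ virtual crossings of types $\alpha,\beta,\alpha,\beta,\dots$ followed by one positive classical crossing. **Proposition.** (i) Let $p<q$ be odd primes. Then $K(p)$ and $K(q)$ are not equivalent. They are distinguished by colorings by the dihedral quandle $\mathbb Z_p$, $x*y=2y-x$, with the operator $x\mapsto x+1$ for type $\beta$ and the identity for $\alpha$ (and for all other types): every diagram equivalent to $K(p)$ has exactly $p$ such colorings, and every diagram equivalent to $K(q)$ has none. (ii) For every odd prime $p$, the diagram $K(p)$ is a knot diagram with exactly one classical crossing, and the classical crossing number of the knot it represents is $1$. (iii) Consequently there are infinitely many pairwise nonequivalent oriented multi-virtual knots of type $T$ with classical crossing number $1$. -/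

import Mathlib

/-!
Oriented multi-virtual link diagrams in the plane are taken in general position with respect to
the height function and are read from bottom to top, one horizontal strip at a time: every strip
contains exactly one minimum, one maximum or one crossing, and otherwise vertical strands.
The orientation of a strand at a given height is a `Bool`: `true` if it runs upwards, `false` if it
runs downwards. A horizontal line that misses the special points meets the diagram in a list of
oriented points, read from left to right.
-/

namespace MultiVirtual

universe u v

/-- The kind of a crossing: classical, where the flag records whether the strand that joins the
bottom left to the top right is the overpass, or virtual of some type `t : T`. -/
inductive CrossingKind (T : Type u) : Type u
  | classical (risingOver : Bool)
  | virt (t : T)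

/-- The same crossing with the roles of its two diagonals exchanged. -/
def CrossingKind.flip {T : Type u} : CrossingKind T → CrossingKind T
  | .classical o => .classical (!o)
  | .virt t => .virt t

/-- The pieces a strip may contain.
* `cup e` : a minimum whose left leg is oriented by `e` (and right leg by `!e`);
* `cap e` : a maximum whose left leg is oriented by `e` (and right leg by `!e`);
* `cross k a b` : a crossing of kind `k` of the strand from the bottom left to the top right,
  oriented by `a`, with the strand from the bottom right to the top left, oriented by `b`. -/
inductive Piece (T : Type u) : Type u
  | cup (e : Bool)
  | cap (e : Bool)
  | cross (k : CrossingKind T) (a b : Bool)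

/-- The oriented points on the bottom of a piece. -/
def Piece.src {T : Type u} : Piece T → List Bool
  | .cup _ => []
  | .cap e => [e, !e]
  | .cross _ a b => [a, b]

/-- The oriented points on the top of a piece. -/
def Piece.dst {T : Type u} : Piece T → List Bool
  | .cup e => [e, !e]
  | .cap _ => []
  | .cross _ a b => [b, a]

/-- A strip: one piece, with vertical strands to the left and to the right of it. -/
structure Strip (T : Type u) : Type u where
  left : List Bool
  piece : Piece T
  right : List Bool

/-- The oriented points on the bottom of a strip. -/
def Strip.src {T : Type u} (s : Strip T) : List Bool := s.left ++ s.piece.src ++ s.right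

/-- The oriented points on the top of a strip. -/
def Strip.dst {T : Type u} (s : Strip T) : List Bool := s.left ++ s.piece.dst ++ s.right

/-- `IsTangle a w b`: the strips of `w`, stacked from bottom to top, fit together to an oriented
tangle diagram with bottom points `a` and top points `b`. -/
def IsTangle {T : Type u} : List Bool → List (Strip T) → List Bool → Prop
  | a, [], b => a = b
  | a, s :: w, b => s.src = a ∧ IsTangle s.dst w b

theorem IsTangle.append {T : Type u} {b c : List Bool} {w' : List (Strip T)} :
    ∀ {a : List Bool} {w : List (Strip T)}, IsTangle a w b → IsTangle b w' c →
      IsTangle a (w ++ w') c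
  | _, [], h, h' => by
      have h0 := h
      simp only [IsTangle] at h0
      subst h0
      exact h'
  | _, _ :: _, h, h' => ⟨h.1, IsTangle.append h.2 h'⟩

/-- Add vertical strands `l` to the left and `r` to the right of a stack of strips. -/
def pad {T : Type u} (l r : List Bool) (w : List (Strip T)) : List (Strip T) :=
  w.map fun s => ⟨l ++ s.left, s.piece, s.right ++ r⟩

/-- An oriented multi-virtual link diagram with virtual crossings typed by `T`. -/
structure LinkDiagram (T : Type u) : Type u where
  strips : List (Strip T)
  closed : IsTangle [] strips []

/-! ### Equivalence of diagrams -/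

/-- Planar isotopy moves of diagrams in general position: two pieces far apart exchange their
heights, a maximum and an adjacent minimum are straightened, and a strand that crosses one leg of
a maximum (minimum) is swung to the other leg. -/
inductive PlanarIsotopy {T : Type u} : List (Strip T) → List (Strip T) → Prop
  | exchange (g h : Piece T) (m : List Bool) :
      PlanarIsotopy
        [⟨[], g, m ++ h.src⟩, ⟨g.dst ++ m, h, []⟩]
        [⟨g.src ++ m, h, []⟩, ⟨[], g, m ++ h.dst⟩]
  | straightenLeft (e : Bool) :
      PlanarIsotopy [⟨[e], .cup (!e), []⟩, ⟨[], .cap e, [e]⟩] []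
  | straightenRight (e : Bool) :
      PlanarIsotopy [⟨[], .cup e, [e]⟩, ⟨[e], .cap (!e), []⟩] []
  | swingMax (k : CrossingKind T) (e c : Bool) :
      PlanarIsotopy
        [⟨[e], .cross k c (!e), []⟩, ⟨[], .cap e, [c]⟩]
        [⟨[], .cross k.flip e c, [!e]⟩, ⟨[c], .cap e, []⟩]
  | swingMin (k : CrossingKind T) (e c : Bool) :
      PlanarIsotopy
        [⟨[], .cup e, [c]⟩, ⟨[e], .cross k (!e) c, []⟩]
        [⟨[c], .cup e, []⟩, ⟨[], .cross k.flip c e, [!e]⟩]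

/-- A strand oriented by `e` with a kink to its right, whose crossing is of kind `k`. -/
def kinkRight {T : Type u} (k : CrossingKind T) (e : Bool) : List (Strip T) :=
  [⟨[e], .cup e, []⟩, ⟨[], .cross k e e, [!e]⟩, ⟨[e], .cap e, []⟩]

/-- A strand oriented by `e` with a kink to its left, whose crossing is of kind `k`. -/
def kinkLeft {T : Type u} (k : CrossingKind T) (e : Bool) : List (Strip T) :=
  [⟨[], .cup (!e), [e]⟩, ⟨[!e], .cross k e e, []⟩, ⟨[], .cap (!e), [e]⟩]

/-- The classical Reidemeister moves, with all orientations. In the third move `o₁`, `o₂`, `o₃`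
say whether strand 1 passes over 2, strand 1 over 3 and strand 2 over 3; the hypothesis says that
one of the three strands is on top and one at the bottom. -/
inductive ClassicalReidemeister {T : Type u} : List (Strip T) → List (Strip T) → Prop
  | r1Right (o e : Bool) : ClassicalReidemeister (kinkRight (.classical o) e) []
  | r1Left (o e : Bool) : ClassicalReidemeister (kinkLeft (.classical o) e) []
  | r2 (o a b : Bool) :
      ClassicalReidemeister
        [⟨[], .cross (.classical o) a b, []⟩, ⟨[], .cross (.classical (!o)) b a, []⟩] []
  | r3 (o₁ o₂ o₃ a b c : Bool) (ho : o₁ = o₃ → o₂ = o₁) :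
      ClassicalReidemeister
        [⟨[], .cross (.classical o₁) a b, [c]⟩, ⟨[b], .cross (.classical o₂) a c, []⟩,
          ⟨[], .cross (.classical o₃) b c, [a]⟩]
        [⟨[a], .cross (.classical o₃) b c, []⟩, ⟨[], .cross (.classical o₂) a c, [b]⟩,
          ⟨[c], .cross (.classical o₁) a b, []⟩]

/-- A strand oriented by `e` that starts on the left of the strands `a` and passes to their right,
meeting each of them in a virtual crossing of type `t`. -/
def passRight {T : Type u} (t : T) (e : Bool) : List Bool → List (Strip T)
  | [] => []
  | b :: a => ⟨[], .cross (.virt t) e b, a⟩ :: pad [b] [] (passRight t e a)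

/-- A strand oriented by `e` that starts on the right of the strands `a` and passes to their left,
meeting each of them in a virtual crossing of type `t`. -/
def passLeft {T : Type u} (t : T) (e : Bool) : List Bool → List (Strip T)
  | [] => []
  | b :: a => pad [b] [] (passLeft t e a) ++ [⟨[], .cross (.virt t) b e, a⟩]

/-- The multi-virtual detour moves: a strand that meets the strands `a` at one end of a tangle `w`
in virtual crossings of one type is moved across `w`, so that it meets the strands `b` at the
other end in virtual crossings of the same type; and loops with a virtual crossing are added to or
removed from a strand. -/
inductive Detour {T : Type u} : List (Strip T) → List (Strip T) → Prop
  | acrossRight (t : T) (e : Bool) (a b : List Bool) (w : List (Strip T)) (hw : IsTangle a w b) :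
      Detour (passRight t e a ++ pad [] [e] w) (pad [e] [] w ++ passRight t e b)
  | acrossLeft (t : T) (e : Bool) (a b : List Bool) (w : List (Strip T)) (hw : IsTangle a w b) :
      Detour (passLeft t e a ++ pad [e] [] w) (pad [] [e] w ++ passLeft t e b)
  | loopRight (t : T) (e : Bool) : Detour (kinkRight (.virt t) e) []
  | loopLeft (t : T) (e : Bool) : Detour (kinkLeft (.virt t) e) []

/-- `E` is obtained from `D` by replacing one part `x` by `y` according to one of the moves. -/
def LinkDiagram.Step {T : Type u} (D E : LinkDiagram T) : Prop :=
  ∃ (below above x y : List (Strip T)) (l r : List Bool),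
    (PlanarIsotopy x y ∨ ClassicalReidemeister x y ∨ Detour x y) ∧
    D.strips = below ++ pad l r x ++ above ∧ E.strips = below ++ pad l r y ++ above

/-- Equivalence of oriented multi-virtual link diagrams: finitely many planar isotopies, classical
Reidemeister moves and multi-virtual detour moves, in either direction. -/
def LinkDiagram.Equivalent {T : Type u} (D E : LinkDiagram T) : Prop :=
  Relation.EqvGen LinkDiagram.Step D E

instance LinkDiagram.setoid (T : Type u) : Setoid (LinkDiagram T) :=
  Relation.EqvGen.setoid LinkDiagram.Step

/-- Oriented multi-virtual links: equivalence classes of diagrams. -/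
abbrev Link (T : Type u) : Type u := Quotient (LinkDiagram.setoid T)

/-- The multi-virtual link presented by a diagram. -/
def LinkDiagram.link {T : Type u} (D : LinkDiagram T) : Link T := Quotient.mk _ D

/-! ### Knots and the classical crossing number -/

/-- `(i, j)` is the `j`-th point (from the left) on the bottom of the `i`-th strip. -/
def LinkDiagram.IsPoint {T : Type u} (D : LinkDiagram T) (x : ℕ × ℕ) : Prop :=
  ∃ s, D.strips[x.1]? = some s ∧ x.2 < s.src.length

/-- Two points of a diagram are joined by a segment of strand inside one strip; strands go straight
through crossings. -/
inductive LinkDiagram.Joined {T : Type u} (D : LinkDiagram T) : ℕ × ℕ → ℕ × ℕ → Prop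
  | left (i j : ℕ) (s : Strip T) (hs : D.strips[i]? = some s) (hj : j < s.left.length) :
      D.Joined (i, j) (i + 1, j)
  | right (i j : ℕ) (s : Strip T) (hs : D.strips[i]? = some s) (hj : j < s.right.length) :
      D.Joined (i, s.left.length + s.piece.src.length + j)
        (i + 1, s.left.length + s.piece.dst.length + j)
  | cup (i : ℕ) (s : Strip T) (e : Bool) (hs : D.strips[i]? = some s) (hp : s.piece = .cup e) :
      D.Joined (i + 1, s.left.length) (i + 1, s.left.length + 1)
  | cap (i : ℕ) (s : Strip T) (e : Bool) (hs : D.strips[i]? = some s) (hp : s.piece = .cap e) :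
      D.Joined (i, s.left.length) (i, s.left.length + 1)
  | rising (i : ℕ) (s : Strip T) (k : CrossingKind T) (a b : Bool)
      (hs : D.strips[i]? = some s) (hp : s.piece = .cross k a b) :
      D.Joined (i, s.left.length) (i + 1, s.left.length + 1)
  | falling (i : ℕ) (s : Strip T) (k : CrossingKind T) (a b : Bool)
      (hs : D.strips[i]? = some s) (hp : s.piece = .cross k a b) :
      D.Joined (i, s.left.length + 1) (i + 1, s.left.length)

/-- A diagram of a knot: it has exactly one component. -/
def LinkDiagram.IsKnot {T : Type u} (D : LinkDiagram T) : Prop :=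
  (∃ x, D.IsPoint x) ∧
    ∀ x y, D.IsPoint x → D.IsPoint y → Relation.EqvGen D.Joined x y

/-- Is the piece of this strip a classical crossing? -/
def Strip.isClassical {T : Type u} (s : Strip T) : Bool :=
  match s.piece with
  | .cross (.classical _) _ _ => true
  | _ => false

/-- The number of classical crossings of a diagram. -/
def LinkDiagram.classicalCrossings {T : Type u} (D : LinkDiagram T) : ℕ :=
  D.strips.countP Strip.isClassical

/-- A multi-virtual knot: a link that has a knot diagram. -/
def Link.IsKnot {T : Type u} (L : Link T) : Prop := ∃ D : LinkDiagram T, D.link = L ∧ D.IsKnot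

/-- The classical crossing number: the least number of classical crossings in a diagram of `L`. -/
noncomputable def Link.classicalCrossingNumber {T : Type u} (L : Link T) : ℕ :=
  sInf {n | ∃ D : LinkDiagram T, D.link = L ∧ D.classicalCrossings = n}

/-! ### Operator quandle colorings

The quandle product `x * y` (right translations being automorphisms) is `y ◃ x` in Mathlib. -/

/-- A list, indexed by `T`, of pairwise commuting automorphisms of the quandle `Q`. -/
structure Operators (T : Type u) (Q : Type v) [Quandle Q] where
  op : T → Equiv.Perm Q
  map_act : ∀ t x y, op t (Shelf.act x y) = Shelf.act (op t x) (op t y)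
  comm : ∀ s t, op s * op t = op t * op s

/-- The coloring rule at a crossing. Here `x`, `y` are the colors on the bottom left and bottom
right, and `z`, `w` those on the top left and top right; the strand from bottom left to top right
is oriented by `a` and the other one by `b`.

Classical crossing: the color of the overpass does not change, and if the overpass has color `o`
and the underpass has color `c` to the right of the overpass, then the underpass has color
`c * o = o ◃ c` to its left.

Virtual crossing of type `t`: a strand of color `c` gets the color `t c` after crossing a strand
that passes from left to right, and `t⁻¹ c` after crossing one that passes from right to left. -/
def crossRule {T : Type u} {Q : Type v} [Quandle Q] (A : Operators T Q) :
    CrossingKind T → Bool → Bool → Q → Q → Q → Q → Prop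
  | .classical true, a, _, x, y, z, w =>
      w = x ∧ if a then z = Shelf.act x y else y = Shelf.act x z
  | .classical false, _, b, x, y, z, w =>
      z = y ∧ if b then x = Shelf.act y w else w = Shelf.act y x
  | .virt t, a, b, x, y, z, w =>
      (z = if a then A.op t y else (A.op t).symm y) ∧
        (w = if b then (A.op t).symm x else A.op t x)

/-- The coloring rule for a piece with colors `p` on the bottom and `q` on the top. -/
def pieceRule {T : Type u} {Q : Type v} [Quandle Q] (A : Operators T Q) :
    Piece T → List Q → List Q → Prop
  | .cup _, p, q => p = [] ∧ ∃ x, q = [x, x]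
  | .cap _, p, q => (∃ x, p = [x, x]) ∧ q = []
  | .cross k a b, p, q => ∃ x y z w, p = [x, y] ∧ q = [z, w] ∧ crossRule A k a b x y z w

/-- The coloring rule for a strip: colors do not change along the vertical strands. -/
def stripRule {T : Type u} {Q : Type v} [Quandle Q] (A : Operators T Q) (s : Strip T)
    (c d : List Q) : Prop :=
  ∃ l p q r : List Q, l.length = s.left.length ∧ r.length = s.right.length ∧
    pieceRule A s.piece p q ∧ c = l ++ p ++ r ∧ d = l ++ q ++ r

/-- An operator quandle coloring of `D`: `color i` lists the colors of the points on the bottom of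
the `i`-th strip (and is empty above the diagram). -/
structure Coloring {T : Type u} (D : LinkDiagram T) {Q : Type v} [Quandle Q]
    (A : Operators T Q) where
  color : ℕ → List Q
  zero : color 0 = []
  rule : ∀ (i : ℕ) (hi : i < D.strips.length), stripRule A D.strips[i] (color i) (color (i + 1))
  above : ∀ i, D.strips.length ≤ i → color i = []

/-- The number of colorings of `D` by an operator quandle. -/
noncomputable def col {T : Type u} (D : LinkDiagram T) {Q : Type v} [Quandle Q]
    (A : Operators T Q) : ℕ∞ :=
  ENat.card (Coloring D A)

/-- The automorphism `x ↦ x + 1` of the dihedral quandle on `ℤ/m`. -/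
def dihedralShift (m : ℕ) : Equiv.Perm (Quandle.Dihedral m) :=
  (Equiv.addRight (1 : ZMod m) : Equiv.Perm (ZMod m))

theorem dihedralShift_act (m : ℕ) (x y : Quandle.Dihedral m) :
    dihedralShift m (Shelf.act x y) = Shelf.act (dihedralShift m x) (dihedralShift m y) := by
  have key : ∀ x y : ZMod m, Quandle.dihedralAct m x y + 1 =
      Quandle.dihedralAct m (x + 1) (y + 1) := by
    intro x y
    simp only [Quandle.dihedralAct]
    ring
  exact key x y

open Classical in
/-- The dihedral quandle on `ℤ/m` with the operator `x ↦ x + 1` for virtual crossings of type `β`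
and the identity for all other types. -/
noncomputable def dihedralOperators {T : Type u} (β : T) (m : ℕ) :
    Operators T (Quandle.Dihedral m) where
  op t := if t = β then dihedralShift m else 1
  map_act t x y := by
    split_ifs
    · exact dihedralShift_act m x y
    · rfl
  comm s t := by split_ifs <;> simp

/-! ### The knots `K(n)` -/

/-- The strips of `K(n)`: two upward strands between two closing arcs, on which `2n` virtual
crossings of types `α, β, α, β, …` are followed by one positive classical crossing. -/
def knotKStrips {T : Type u} (α β : T) (n : ℕ) : List (Strip T) :=
  [⟨[], .cup false, []⟩, ⟨[false, true], .cup true, []⟩] ++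
    (List.replicate n
      [⟨[false], .cross (.virt α) true true, [false]⟩,
        ⟨[false], .cross (.virt β) true true, [false]⟩]).flatten ++
    [⟨[false], .cross (.classical true) true true, [false]⟩] ++
    [⟨[], .cap false, [true, false]⟩, ⟨[], .cap true, []⟩]

theorem isTangle_twists {T : Type u} (α β : T) (n : ℕ) :
    IsTangle [false, true, true, false]
      (List.replicate n
        [(⟨[false], .cross (.virt α) true true, [false]⟩ : Strip T),
          ⟨[false], .cross (.virt β) true true, [false]⟩]).flatten
      [false, true, true, false] := by
  induction n with
  | zero => exact rfl
  | succ n ih => exact ⟨rfl, rfl, ih⟩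

/-- The oriented multi-virtual knot diagram `K(n)`. -/
def knotK {T : Type u} (α β : T) (n : ℕ) : LinkDiagram T where
  strips := knotKStrips α β n
  closed := by
    unfold knotKStrips
    refine IsTangle.append (b := [false, true, true, false]) ?_ ⟨rfl, rfl, rfl⟩
    refine IsTangle.append (b := [false, true, true, false]) ?_ ⟨rfl, rfl⟩
    exact IsTangle.append (b := [false, true, true, false]) ⟨rfl, rfl, rfl⟩
      (isTangle_twists α β n)

end MultiVirtual

namespace MultiVirtual

universe u v

variable {T : Type u}

section

/-! The number of colorings by a finite operator quandle is a link invariant, and two such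
invariants prove everything.

For invariance, colorings are counted by transfer matrices. A strip sends a function on rows of
colors above it to a function on rows below it (`stripSum`), a stack of strips gives the composite
(`colorSum`), and a closed diagram yields the number of its colorings (`col_eq_colorSum`). Since
vertical strands only carry their colors along (`colorSum_pad`), each move can be checked on its
own. The Reidemeister moves are the quandle axioms. In a detour the moving strand applies one
operator to all the strands it meets. This operator is an automorphism commuting with all operators,
so it passes through every coloring of the tangle (`colorSum_map_signedOp`). The moving strand
itself changes by a power of the operator that depends only on the signed number of end points,
which is the same at both ends (`transportRight_eq`, `transportLeft_eq`).

If `α` acts trivially and `β` by `B`, the colorings of `K(n)` are the solutions of `B^n x ◃ x = x`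
(`colorSum_knotK`). In the dihedral quandle on `ℤ/m` with `B x = x + 1` this says `2n = 0`, so there
are `m` colorings or none. Modulus `p` separates `K(p)` from `K(q)`.

A diagram without classical crossings never uses the quandle product, so it has as many dihedral
colorings as colorings by the trivial quandle with the same operators. For `K(n)` with `n` odd and
modulus 4 these numbers are 0 and 4, so a classical crossing is unavoidable. -/

theorem Strip.exists_split (s : Strip T) {Q : Type v} {c : List Q} (hc : c.length = s.src.length) :
    ∃ l p r : List Q, l.length = s.left.length ∧ p.length = s.piece.src.length ∧
      r.length = s.right.length ∧ c = l ++ p ++ r := by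
  simp only [Strip.src, List.length_append] at hc
  refine ⟨c.take s.left.length, (c.drop s.left.length).take s.piece.src.length,
    (c.drop s.left.length).drop s.piece.src.length, ?_, ?_, ?_, ?_⟩ <;> simp <;> omega

variable {Q : Type v} [Quandle Q]

/-! ### The coloring rules as functions -/

/-- The translation by `x`, or its inverse, according to the orientation `e`. -/
def signedAct (e : Bool) (x y : Q) : Q :=
  if e then Shelf.act x y else Rack.invAct x y

theorem signedAct_self (e : Bool) (x : Q) : signedAct e x x = x := by
  cases e <;> simp [signedAct]

theorem signedAct_not_cancel (e : Bool) (x y : Q) : signedAct (!e) x (signedAct e x y) = y := by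
  cases e <;> simp [signedAct]

theorem signedAct_cancel_not (e : Bool) (x y : Q) : signedAct e x (signedAct (!e) x y) = y := by
  cases e <;> simp [signedAct]

/-- Translations and their inverses are automorphisms of the quandle, so they also respect inverse
translations. The inverse cases follow from self-distributivity by cancelling a translation. -/
theorem signedAct_distrib (e e' : Bool) (x y z : Q) :
    signedAct e x (signedAct e' y z) = signedAct e' (signedAct e x y) (signedAct e x z) := by
  have key : ∀ (e : Bool) (x y z : Q),
      signedAct e x (Shelf.act y z) = Shelf.act (signedAct e x y) (signedAct e x z) := by
    intro e x y z
    cases e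
    · refine (Rack.left_cancel x).mp ?_
      simp only [signedAct, Bool.false_eq_true, if_false]
      rw [Shelf.self_distrib, Rack.right_inv, Rack.right_inv, Rack.right_inv]
    · exact Shelf.self_distrib
  cases e'
  · refine (Rack.left_cancel (signedAct e x y)).mp ?_
    have := key e x y (Rack.invAct y z)
    rw [Rack.right_inv] at this
    simp [signedAct] at this ⊢
    exact this.symm
  · simpa [signedAct] using key e x y z

theorem Operators.map_signedAct (A : Operators T Q) (t : T) (e : Bool) (x y : Q) :
    A.op t (signedAct e x y) = signedAct e (A.op t x) (A.op t y) := by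
  cases e
  · refine (Rack.left_cancel (A.op t x)).mp ?_
    have := A.map_act t x (Rack.invAct x y)
    rw [Rack.right_inv] at this
    simp [signedAct, ← this]
  · simp [signedAct, A.map_act]

/-- The operator of type `t`, or its inverse, according to the orientation `e`. -/
def Operators.signedOp (A : Operators T Q) (t : T) (e : Bool) : Equiv.Perm Q :=
  if e then A.op t else (A.op t).symm

theorem Operators.signedOp_not (A : Operators T Q) (t : T) (e : Bool) :
    A.signedOp t (!e) = (A.signedOp t e).symm := by
  cases e <;> rfl

theorem Operators.signedOp_not_cancel (A : Operators T Q) (t : T) (e : Bool) (x : Q) :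
    A.signedOp t (!e) (A.signedOp t e x) = x := by
  simp [A.signedOp_not]

theorem Operators.signedOp_cancel_not (A : Operators T Q) (t : T) (e : Bool) (x : Q) :
    A.signedOp t e (A.signedOp t (!e) x) = x := by
  simp [A.signedOp_not]

theorem Operators.signedOp_comm (A : Operators T Q) (s t : T) (e e' : Bool) (x : Q) :
    A.signedOp s e (A.signedOp t e' x) = A.signedOp t e' (A.signedOp s e x) := by
  have h : Commute (A.op s) (A.op t) := A.comm s t
  have hc : Commute (A.signedOp s e) (A.signedOp t e') := by
    cases e <;> cases e'
    · exact h.inv_inv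
    · exact h.inv_left
    · exact h.inv_right
    · exact h
  exact DFunLike.congr_fun hc x

theorem Operators.signedOp_signedAct (A : Operators T Q) (t : T) (e e' : Bool) (x y : Q) :
    A.signedOp t e (signedAct e' x y) =
      signedAct e' (A.signedOp t e x) (A.signedOp t e y) := by
  cases e
  · simp [signedOp, Equiv.symm_apply_eq, A.map_signedAct]
  · exact A.map_signedAct t e' x y

/-- The colors on the top left and top right of a crossing in terms of those on the bottom. -/
def crossMap (A : Operators T Q) : CrossingKind T → Bool → Bool → Q → Q → Q × Q
  | .classical true, a, _, x, y => (signedAct a x y, x)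
  | .classical false, _, b, x, y => (y, signedAct (!b) y x)
  | .virt t, a, b, x, y => (A.signedOp t a y, A.signedOp t (!b) x)

/-- Translations and operators are invertible, so the bottom colors of a crossing determine the top
ones whatever the orientations. -/
theorem crossRule_iff (A : Operators T Q) (k : CrossingKind T) (a b : Bool) (x y z w : Q) :
    crossRule A k a b x y z w ↔ crossMap A k a b x y = (z, w) := by
  have inv : ∀ x y z : Q, y = Shelf.act x z ↔ Rack.invAct x y = z := fun x y z =>
    ⟨fun h => by simp [h], fun h => by simp [← h]⟩
  rcases k with (_ | _) | t <;> cases a <;> cases b <;>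
    simp [crossRule, crossMap, signedAct, Operators.signedOp, inv, eq_comm, and_comm]

/-- At a classical crossing this holds because operators are automorphisms, at a virtual one because
they commute. -/
theorem crossMap_signedOp (A : Operators T Q) (k : CrossingKind T) (a b : Bool) (t : T) (e : Bool)
    (x y : Q) :
    crossMap A k a b (A.signedOp t e x) (A.signedOp t e y) =
      (A.signedOp t e (crossMap A k a b x y).1, A.signedOp t e (crossMap A k a b x y).2) := by
  rcases k with (_ | _) | s
  · simp only [crossMap, A.signedOp_signedAct]
  · simp only [crossMap, A.signedOp_signedAct]
  · simp only [crossMap, A.signedOp_comm s t]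

/-! ### Transfer sums over rows of colors -/

variable [Fintype Q] [DecidableEq Q]

/-- The sum of `f` over all possible colors above a piece whose bottom points are the first points
of a row with the colors `c`. -/
def pieceSum (A : Operators T Q) : Piece T → List Q → (List Q → ℕ) → ℕ
  | .cup _, c, f => ∑ x, f (x :: x :: c)
  | .cap _, x :: y :: c, f => if x = y then f c else 0
  | .cross k a b, x :: y :: c, f =>
      f ((crossMap A k a b x y).1 :: (crossMap A k a b x y).2 :: c)
  -- Junk value for rows too short for the piece; it never occurs for rows of the right length.
  | _, _, _ => 0

/-- The sum of `f` over all possible colors above a strip with the colors `c` on its bottom. -/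
def stripSum (A : Operators T Q) (s : Strip T) (c : List Q) (f : List Q → ℕ) : ℕ :=
  pieceSum A s.piece (c.drop s.left.length) fun d => f (c.take s.left.length ++ d)

/-- The sum of `f` over the top colors of all colorings of `w` with the colors `c` at the
bottom. -/
def colorSum (A : Operators T Q) : List (Strip T) → List Q → (List Q → ℕ) → ℕ
  | [], c, f => f c
  | s :: w, c, f => stripSum A s c fun d => colorSum A w d f

theorem colorSum_append (A : Operators T Q) (w w' : List (Strip T)) (c : List Q)
    (f : List Q → ℕ) :
    colorSum A (w ++ w') c f = colorSum A w c fun d => colorSum A w' d f := by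
  induction w generalizing c with
  | nil => rfl
  | cons s w ih => simp only [List.cons_append, colorSum, ih]

theorem pieceSum_congr (A : Operators T Q) (p : Piece T) {c : List Q}
    (hc : c.length = p.src.length) {f g : List Q → ℕ}
    (h : ∀ d : List Q, d.length = p.dst.length → f d = g d) :
    pieceSum A p c f = pieceSum A p c g := by
  match p, c, hc with
  | .cup _, [], _ => exact Finset.sum_congr rfl fun x _ => h _ rfl
  | .cap _, [x, y], _ => simp only [pieceSum]; rw [h _ rfl]
  | .cross _ _ _, [x, y], _ => exact h _ rfl

theorem pieceSum_append (A : Operators T Q) (p : Piece T) {c : List Q}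
    (hc : c.length = p.src.length) (r : List Q) (f : List Q → ℕ) :
    pieceSum A p (c ++ r) f = pieceSum A p c fun d => f (d ++ r) := by
  match p, c, hc with
  | .cup _, [], _ => rfl
  | .cap _, [x, y], _ => rfl
  | .cross _ _ _, [x, y], _ => rfl

theorem stripSum_append (A : Operators T Q) (s : Strip T) {l c r : List Q}
    (hl : l.length = s.left.length) (hc : c.length = s.piece.src.length) (f : List Q → ℕ) :
    stripSum A s (l ++ c ++ r) f = pieceSum A s.piece c fun d => f (l ++ d ++ r) := by
  simp only [stripSum, List.append_assoc, ← hl, List.drop_left, List.take_left]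
  exact pieceSum_append A s.piece hc r _

theorem stripSum_congr (A : Operators T Q) (s : Strip T) {c : List Q}
    (hc : c.length = s.src.length) {f g : List Q → ℕ}
    (h : ∀ d : List Q, d.length = s.dst.length → f d = g d) :
    stripSum A s c f = stripSum A s c g := by
  obtain ⟨l, p, r, hl, hp, hr, rfl⟩ := s.exists_split hc
  rw [stripSum_append A s hl hp, stripSum_append A s hl hp]
  exact pieceSum_congr A _ hp fun d hd => h _ (by simp [Strip.dst, *])

theorem colorSum_congr (A : Operators T Q) {w : List (Strip T)} {a b : List Bool}
    (hw : IsTangle a w b) {c : List Q} (hc : c.length = a.length) {f g : List Q → ℕ}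
    (h : ∀ d : List Q, d.length = b.length → f d = g d) :
    colorSum A w c f = colorSum A w c g := by
  induction w generalizing a c with
  | nil => obtain rfl : a = b := hw; exact h c hc
  | cons s w ih =>
    obtain ⟨rfl, hw⟩ := hw
    exact stripSum_congr A s hc fun d hd => ih hw hd

/-- Locality: colors beside a tangle are mere parameters, so a move can be checked without its
surroundings. -/
theorem colorSum_pad (A : Operators T Q) {w : List (Strip T)} {a b l r : List Bool}
    (hw : IsTangle a w b) {c L R : List Q} (hL : L.length = l.length) (hc : c.length = a.length)
    (f : List Q → ℕ) :
    colorSum A (pad l r w) (L ++ c ++ R) f = colorSum A w c fun d => f (L ++ d ++ R) := by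
  induction w generalizing a c with
  | nil => rfl
  | cons s w ih =>
    obtain ⟨rfl, hw⟩ := hw
    have key : ∀ g : List Q → ℕ,
        stripSum A ⟨l ++ s.left, s.piece, s.right ++ r⟩ (L ++ c ++ R) g =
          stripSum A s c fun d => g (L ++ d ++ R) := by
      intro g
      obtain ⟨l', p, r', hl, hp, hr, rfl⟩ := s.exists_split hc
      rw [stripSum_append A s hl hp,
        show L ++ (l' ++ p ++ r') ++ R = (L ++ l') ++ p ++ (r' ++ R) by simp,
        stripSum_append A ⟨l ++ s.left, s.piece, s.right ++ r⟩ (by simp [hL, hl]) hp]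
      simp only [List.append_assoc]
    change stripSum A ⟨l ++ s.left, s.piece, s.right ++ r⟩ (L ++ c ++ R)
      (fun d => colorSum A (pad l r w) d f) = stripSum A s c _
    rw [key]
    exact stripSum_congr A s hc fun d hd => ih hw hd

/-! ### Counting colorings -/

/-- Bridge from the coloring relation to the sums: the admissible rows above a strip form a finite
set, and `stripSum` counts each of them exactly once. -/
theorem exists_finset_stripRule (A : Operators T Q) (s : Strip T) {c : List Q}
    (hc : c.length = s.src.length) :
    ∃ F : Finset (List Q), (∀ d, d ∈ F ↔ stripRule A s c d) ∧
      (∀ d ∈ F, d.length = s.dst.length) ∧ ∀ f, ∑ d ∈ F, f d = stripSum A s c f := by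
  obtain ⟨l, p, r, hl, hp, hr, rfl⟩ := s.exists_split hc
  have hrule : ∀ d, stripRule A s (l ++ p ++ r) d ↔
      ∃ q, pieceRule A s.piece p q ∧ l ++ q ++ r = d := by
    intro d
    constructor
    · rintro ⟨l', p', q, r', hl', hr', hq, h, rfl⟩
      -- The lengths of the side strands fix where the row is cut.
      have h1 := List.append_inj' h (by omega)
      obtain ⟨rfl, rfl⟩ := List.append_inj h1.1 (by omega)
      exact ⟨q, hq, by rw [h1.2]⟩
    · rintro ⟨q, hq, rfl⟩
      exact ⟨l, p, q, r, hl, hr, hq, rfl, rfl⟩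
  suffices ∃ F : Finset (List Q), (∀ q, q ∈ F ↔ pieceRule A s.piece p q) ∧
      (∀ d ∈ F, d.length = s.piece.dst.length) ∧ ∀ f, ∑ q ∈ F, f q = pieceSum A s.piece p f by
    obtain ⟨F, hF, hF', hs⟩ := this
    refine ⟨F.image fun q => l ++ q ++ r, ?_, ?_, ?_⟩
    · intro d
      simp only [hrule, Finset.mem_image, hF]
    · simp only [Finset.mem_image]
      rintro _ ⟨q, hq, rfl⟩
      simp [Strip.dst, hl, hr, hF' q hq]
    · intro f
      rw [Finset.sum_image fun q _ q' _ h => by simpa using h, hs, stripSum_append A s hl hp]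
  generalize s.piece = P at *
  match P, p, hp with
  | .cup _, [], _ =>
    refine ⟨Finset.univ.image fun x => [x, x], ?_, ?_, ?_⟩
    · simp [pieceRule, eq_comm]
    · simp [Piece.dst]
    · intro f
      rw [Finset.sum_image fun q _ q' _ h => by simpa using h]
      rfl
  | .cap _, [x, y], _ =>
    refine ⟨if x = y then {[]} else ∅, ?_, ?_, ?_⟩
    · intro q
      split_ifs with h
      · simp [pieceRule, h]
      · simp only [pieceRule, List.cons.injEq, Finset.notMem_empty, false_iff]
        rintro ⟨⟨z, rfl, rfl, -⟩, -⟩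
        exact h rfl
    · intro d
      split_ifs <;> simp [Piece.dst]
    · intro f
      split_ifs with h <;> simp [pieceSum, h]
  | .cross k a b, [x, y], _ =>
    refine ⟨{[(crossMap A k a b x y).1, (crossMap A k a b x y).2]}, ?_, ?_, ?_⟩
    · intro q
      simp only [pieceRule, Finset.mem_singleton, crossRule_iff]
      constructor
      · rintro rfl
        exact ⟨x, y, _, _, rfl, rfl, rfl⟩
      · rintro ⟨x', y', z, w, h, rfl, h'⟩
        simp only [List.cons.injEq, and_true] at h
        rw [h.1, h.2, h']
    · simp [Piece.dst]
    · simp [pieceSum]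

/-- The colorings of `w` with the colors `c` on the bottom and none on the top. -/
def runs (A : Operators T Q) (w : List (Strip T)) (c : List Q) : Set (ℕ → List Q) :=
  {γ | γ 0 = c ∧ (∀ (i : ℕ) (hi : i < w.length), stripRule A w[i] (γ i) (γ (i + 1))) ∧
    ∀ i, w.length ≤ i → γ i = []}

/-- A coloring of `s :: w` amounts to an admissible row above `s` together with a coloring of `w`
starting from that row; the cardinality of this sigma type is the sum. -/
theorem runs_card (A : Operators T Q) {w : List (Strip T)} {a : List Bool}
    (hw : IsTangle a w []) {c : List Q} (hc : c.length = a.length) :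
    Finite (runs A w c) ∧ Nat.card (runs A w c) = colorSum A w c fun _ => 1 := by
  induction w generalizing a c with
  | nil =>
    obtain rfl : a = [] := hw
    obtain rfl : c = [] := by simpa using hc
    have : runs A ([] : List (Strip T)) [] = {fun _ => []} := by
      ext γ
      simp only [runs, List.length_nil, Set.mem_ofPred_eq, Set.mem_singleton_iff, funext_iff]
      exact ⟨fun h i => h.2.2 i (Nat.zero_le i), fun h => ⟨h 0, by simp, fun i _ => h i⟩⟩
    rw [this]
    exact ⟨inferInstance, by simp [colorSum]⟩
  | cons s w ih =>
    obtain ⟨rfl, hw⟩ := hw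
    obtain ⟨F, hF, hF', hs⟩ := exists_finset_stripRule A s hc
    let φ : runs A (s :: w) c ≃ Σ d : F, runs A w d.1 :=
      { toFun := fun γ => ⟨⟨γ.1 1, (hF _).mpr (by
            have := γ.2.2.1 0 (by simp)
            rwa [γ.2.1] at this)⟩, fun i => γ.1 (i + 1), rfl,
            fun i hi => γ.2.2.1 (i + 1) (by simpa using hi),
            fun i hi => γ.2.2.2 (i + 1) (by simpa using hi)⟩
        invFun := fun δ => ⟨fun | 0 => c | i + 1 => δ.2.1 i, rfl, by
            rintro (_ | i) hi
            · have := (hF _).mp δ.1.2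
              rw [← δ.2.2.1] at this
              exact this
            · exact δ.2.2.2.1 i (by simpa using hi), by
            rintro (_ | i) hi
            · simp at hi
            · exact δ.2.2.2.2 i (by simpa using hi)⟩
        left_inv := fun γ => by
          apply Subtype.ext
          funext i
          rcases i with _ | i
          · exact γ.2.1.symm
          · rfl
        right_inv := fun ⟨⟨d, hd⟩, γ, h0, h⟩ => by
          have h0' : γ 0 = d := h0
          subst h0'
          rfl }
    have hfin : ∀ d : F, Finite (runs A w d.1) := fun d => (ih hw (hF' _ d.2)).1
    refine ⟨Finite.of_equiv _ φ.symm, ?_⟩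
    rw [Nat.card_congr φ, Nat.card_sigma]
    simp only [colorSum]
    rw [← hs, ← Finset.sum_coe_sort F]
    exact Finset.sum_congr rfl fun d _ => (ih hw (hF' _ d.2)).2

theorem col_eq_colorSum (A : Operators T Q) (D : LinkDiagram T) :
    col D A = (colorSum A D.strips [] fun _ => 1 : ℕ) := by
  let φ : Coloring D A ≃ runs A D.strips [] :=
    { toFun := fun γ => ⟨γ.color, γ.zero, γ.rule, γ.above⟩
      invFun := fun γ => ⟨γ.1, γ.2.1, γ.2.2.1, γ.2.2.2⟩
      left_inv := fun _ => rfl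
      right_inv := fun _ => rfl }
  obtain ⟨hfin, hcard⟩ := runs_card A D.closed (c := ([] : List Q)) rfl
  rw [col, ENat.card_congr φ, ← hcard, ENat.card_eq_coe_natCard]

end

section

/-! ### Tangles -/

theorem IsTangle.pad {w : List (Strip T)} {a b : List Bool} (hw : IsTangle a w b)
    (l r : List Bool) : IsTangle (l ++ a ++ r) (MultiVirtual.pad l r w) (l ++ b ++ r) := by
  induction w generalizing a with
  | nil => obtain rfl : a = b := hw; exact rfl
  | cons s w ih =>
    obtain ⟨rfl, hw⟩ := hw
    refine ⟨by simp [Strip.src], ?_⟩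
    have h := ih hw
    rwa [show l ++ s.dst ++ r =
      (⟨l ++ s.left, s.piece, s.right ++ r⟩ : Strip T).dst by simp [Strip.dst]] at h

theorem IsTangle.exists_of_append {w w' : List (Strip T)} {a c : List Bool}
    (h : IsTangle a (w ++ w') c) : ∃ b, IsTangle a w b ∧ IsTangle b w' c := by
  induction w generalizing a with
  | nil => exact ⟨a, rfl, h⟩
  | cons s w ih =>
    obtain ⟨b, h1, h2⟩ := ih h.2
    exact ⟨b, ⟨h.1, h1⟩, h2⟩

theorem IsTangle.unique {w : List (Strip T)} {a b b' : List Bool}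
    (h : IsTangle a w b) (h' : IsTangle a w b') : b = b' := by
  induction w generalizing a with
  | nil => exact h.symm.trans h'
  | cons s w ih => exact ih h.2 h'.2

theorem isTangle_passRight (t : T) (e : Bool) (a : List Bool) :
    IsTangle (e :: a) (passRight t e a) (a ++ [e]) := by
  induction a with
  | nil => exact rfl
  | cons b a ih =>
    have h : IsTangle (b :: e :: a) (pad [b] [] (passRight t e a)) (b :: (a ++ [e])) := by
      simpa using ih.pad [b] []
    exact ⟨rfl, h⟩

theorem isTangle_passLeft (t : T) (e : Bool) (a : List Bool) :
    IsTangle (a ++ [e]) (passLeft t e a) (e :: a) := by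
  induction a with
  | nil => exact rfl
  | cons b a ih =>
    refine IsTangle.append (b := b :: e :: a) ?_ ⟨rfl, rfl⟩
    simpa using ih.pad [b] []

/-! ### Invariance under planar isotopies and classical Reidemeister moves -/

variable {Q : Type v} [Quandle Q] [Fintype Q] [DecidableEq Q]

theorem pieceSum_comm (A : Operators T Q) (g h : Piece T) {p q : List Q}
    (hp : p.length = g.src.length) (hq : q.length = h.src.length) (f : List Q → List Q → ℕ) :
    (pieceSum A g p fun p' => pieceSum A h q fun q' => f p' q') =
      pieceSum A h q fun q' => pieceSum A g p fun p' => f p' q' := by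
  match g, p, hp with
  | .cup _, [], _ =>
    match h, q, hq with
    | .cup _, [], _ => exact Finset.sum_comm
    | .cap _, [x, y], _ => simp only [pieceSum]; split_ifs <;> simp
    | .cross _ _ _, [x, y], _ => rfl
  | .cap _, [x, y], _ =>
    match h, q, hq with
    | .cup _, [], _ => simp only [pieceSum]; split_ifs <;> simp
    | .cap _, [z, w], _ => simp only [pieceSum]; split_ifs <;> simp
    | .cross _ _ _, [z, w], _ => rfl
  | .cross _ _ _, [x, y], _ => rfl

/-- The two pieces act on disjoint blocks of the row, so their sums commute. -/
theorem colorSum_exchange (A : Operators T Q) (g h : Piece T) (m : List Bool) {c : List Q}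
    (hc : c.length = (g.src ++ m ++ h.src).length) (f : List Q → ℕ) :
    colorSum A [⟨[], g, m ++ h.src⟩, ⟨g.dst ++ m, h, []⟩] c f =
      colorSum A [⟨g.src ++ m, h, []⟩, ⟨[], g, m ++ h.dst⟩] c f := by
  obtain ⟨p, M, q, hp, hM, hq, rfl⟩ : ∃ p M q : List Q, p.length = g.src.length ∧
      M.length = m.length ∧ q.length = h.src.length ∧ c = p ++ M ++ q := by
    simp only [List.length_append] at hc
    exact ⟨c.take g.src.length, (c.drop g.src.length).take m.length,
      (c.drop g.src.length).drop m.length, by simp; omega, by simp; omega, by simp; omega,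
      by simp⟩
  have hg : ∀ (r : List Bool) (p q : List Q) (F : List Q → ℕ), p.length = g.src.length →
      stripSum A ⟨[], g, r⟩ (p ++ M ++ q) F = pieceSum A g p fun d => F (d ++ M ++ q) := by
    intro r p q F hp
    simpa using stripSum_append A ⟨[], g, r⟩ (l := []) (r := M ++ q) rfl hp F
  have hh : ∀ (l : List Bool) (p : List Q) (F : List Q → ℕ), p.length = l.length →
      stripSum A ⟨l ++ m, h, []⟩ (p ++ M ++ q) F = pieceSum A h q fun d => F (p ++ M ++ d) := by
    intro l p F hp
    simpa using stripSum_append A ⟨l ++ m, h, []⟩ (l := p ++ M) (r := []) (by simp [hp, hM]) hq F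
  simp only [colorSum]
  rw [hg _ _ _ _ hp, hh _ _ _ hp,
    pieceSum_congr A g hp (g := fun p' => pieceSum A h q fun d => f (p' ++ M ++ d))
      fun d hd => hh _ _ _ hd, pieceSum_comm A g h hp hq]
  exact congrArg _ (funext fun d => (hg _ _ _ _ hp).symm)

/-- The maximum imposes one equation between the colors of its legs. Moving the crossing to the
other leg only solves that equation for the other color. -/
theorem colorSum_cross_cap (A : Operators T Q) (k : CrossingKind T) (e c : Bool) (x y z : Q)
    (f : List Q → ℕ) :
    colorSum A [⟨[e], .cross k c (!e), []⟩, ⟨[], .cap e, [c]⟩] [x, y, z] f =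
      colorSum A [⟨[], .cross k.flip e c, [!e]⟩, ⟨[c], .cap e, []⟩] [x, y, z] f := by
  rcases k with (_ | _) | t
  · by_cases hx : x = z <;> simp [colorSum, stripSum, pieceSum, crossMap, CrossingKind.flip, hx]
  · have h : x = signedAct c y z ↔ signedAct (!c) y x = z :=
      ⟨fun h => by rw [h, signedAct_not_cancel], fun h => by rw [← h, signedAct_cancel_not]⟩
    simp [colorSum, stripSum, pieceSum, crossMap, CrossingKind.flip, h]
  · have h : x = A.signedOp t c z ↔ A.signedOp t (!c) x = z :=
      ⟨fun h => by rw [h, A.signedOp_not_cancel], fun h => by rw [← h, A.signedOp_cancel_not]⟩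
    simp [colorSum, stripSum, pieceSum, crossMap, CrossingKind.flip, h]

/-- The free color of the minimum is read on one side of the crossing or on the other; where these
differ, the sum is reindexed by the translation or operator of the crossing. -/
theorem colorSum_cup_cross (A : Operators T Q) (k : CrossingKind T) (e c : Bool) (z : Q)
    (f : List Q → ℕ) :
    colorSum A [⟨[], .cup e, [c]⟩, ⟨[e], .cross k (!e) c, []⟩] [z] f =
      colorSum A [⟨[c], .cup e, []⟩, ⟨[], .cross k.flip c e, [!e]⟩] [z] f := by
  rcases k with (_ | _) | t
  · simp only [colorSum, stripSum, pieceSum, crossMap, CrossingKind.flip]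
    refine Finset.sum_bij' (fun x _ => signedAct (!c) z x) (fun x _ => signedAct c z x)
      (by simp) (by simp) (fun x _ => signedAct_cancel_not _ _ _)
      (fun x _ => signedAct_not_cancel _ _ _) fun x _ => ?_
    simp [signedAct_cancel_not]
  · simp [colorSum, stripSum, pieceSum, crossMap, CrossingKind.flip]
  · simp only [colorSum, stripSum, pieceSum, crossMap, CrossingKind.flip]
    refine Finset.sum_bij' (fun x _ => A.signedOp t (!c) x) (fun x _ => A.signedOp t c x)
      (by simp) (by simp) (fun x _ => A.signedOp_cancel_not _ _ _)
      (fun x _ => A.signedOp_not_cancel _ _ _) fun x _ => ?_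
    simp [A.signedOp_cancel_not]

/-- The maximum leaves a single color for the loop. At a classical crossing it is the color of the
strand, by idempotence; at a virtual one the two passages through the crossing apply inverse
operators. -/
theorem colorSum_kinkRight (A : Operators T Q) (k : CrossingKind T) (e : Bool) (x : Q)
    (f : List Q → ℕ) : colorSum A (kinkRight k e) [x] f = f [x] := by
  rcases k with (_ | _) | t
  · have h : ∀ y, signedAct (!e) y x = y ↔ y = x := fun y =>
      ⟨fun h => by rw [← signedAct_cancel_not e y x, h, signedAct_self],
        fun h => by rw [h, signedAct_self]⟩
    simp [kinkRight, colorSum, stripSum, pieceSum, crossMap, h]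
  · simp [kinkRight, colorSum, stripSum, pieceSum, crossMap, signedAct_self]
  · simp [kinkRight, colorSum, stripSum, pieceSum, crossMap, A.signedOp_cancel_not]

theorem colorSum_kinkLeft (A : Operators T Q) (k : CrossingKind T) (e : Bool) (x : Q)
    (f : List Q → ℕ) : colorSum A (kinkLeft k e) [x] f = f [x] := by
  rcases k with (_ | _) | t
  · refine (Fintype.sum_eq_single x fun y hy => ?_).trans ?_
    · simp [colorSum, stripSum, pieceSum, crossMap, hy]
    · simp [colorSum, stripSum, pieceSum, crossMap, signedAct_self]
  · have h : ∀ y, y = signedAct e y x ↔ y = x := fun y =>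
      ⟨fun h => by rw [← signedAct_not_cancel e y x, ← h, signedAct_self],
        fun h => by rw [h, signedAct_self]⟩
    simp [kinkLeft, colorSum, stripSum, pieceSum, crossMap, h]
  · refine (Fintype.sum_eq_single (A.signedOp t e x) fun y hy => ?_).trans ?_
    · simp [colorSum, stripSum, pieceSum, crossMap, hy]
    · simp [colorSum, stripSum, pieceSum, crossMap, A.signedOp_not_cancel]

theorem colorSum_reidemeister_two (A : Operators T Q) (o a b : Bool) (x y : Q)
    (f : List Q → ℕ) :
    colorSum A [⟨[], .cross (.classical o) a b, []⟩, ⟨[], .cross (.classical (!o)) b a, []⟩]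
      [x, y] f = f [x, y] := by
  cases o <;>
    simp [colorSum, stripSum, pieceSum, crossMap, signedAct_not_cancel, signedAct_cancel_not]

theorem colorSum_reidemeister_three (A : Operators T Q) (o₁ o₂ o₃ a b c : Bool)
    (ho : o₁ = o₃ → o₂ = o₁) (x y z : Q) (f : List Q → ℕ) :
    colorSum A
        [⟨[], .cross (.classical o₁) a b, [c]⟩, ⟨[b], .cross (.classical o₂) a c, []⟩,
          ⟨[], .cross (.classical o₃) b c, [a]⟩] [x, y, z] f =
      colorSum A
        [⟨[a], .cross (.classical o₃) b c, []⟩, ⟨[], .cross (.classical o₂) a c, [b]⟩,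
          ⟨[c], .cross (.classical o₁) a b, []⟩] [x, y, z] f := by
  have h0 : ∀ (k : CrossingKind T) (a b : Bool) (r : List Bool) (x y : Q) (c : List Q)
      (g : List Q → ℕ), stripSum A ⟨[], .cross k a b, r⟩ (x :: y :: c) g =
        g ((crossMap A k a b x y).1 :: (crossMap A k a b x y).2 :: c) :=
    fun _ _ _ _ _ _ _ _ => rfl
  have h1 : ∀ (k : CrossingKind T) (e a b : Bool) (r : List Bool) (u x y : Q) (c : List Q)
      (g : List Q → ℕ), stripSum A ⟨[e], .cross k a b, r⟩ (u :: x :: y :: c) g =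
        g (u :: (crossMap A k a b x y).1 :: (crossMap A k a b x y).2 :: c) :=
    fun _ _ _ _ _ _ _ _ _ _ => rfl
  simp only [colorSum, h0, h1]
  congr 1
  -- Of the eight patterns `ho` excludes the two cyclic ones. The other six are instances of signed
  -- self-distributivity.
  rcases o₁ with _ | _ <;> rcases o₂ with _ | _ <;> rcases o₃ with _ | _ <;>
    simp only [crossMap, List.cons.injEq, and_true, true_and, true_implies, reduceCtorEq] at ho ⊢
  · exact signedAct_distrib _ _ _ _ _
  · rw [signedAct_distrib (!b) (!c), signedAct_not_cancel]
  · rw [signedAct_distrib b a, signedAct_cancel_not]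
  · exact signedAct_distrib _ _ _ _ _
  · exact (signedAct_distrib _ _ _ _ _).symm
  · exact (signedAct_distrib _ _ _ _ _).symm

end

section

/-! ### Invariance under detour moves -/

section Transport

variable {Q : Type v} [Quandle Q]

/-- The color of a strand with the color `x` on the left of the strands `a` after it has passed to
their right in virtual crossings of type `t`. -/
def transportRight (A : Operators T Q) (t : T) (a : List Bool) (x : Q) : Q :=
  a.foldl (fun x b => A.signedOp t (!b) x) x

/-- The color of a strand with the color `x` on the right of the strands `a` after it has passed to
their left in virtual crossings of type `t`. -/
def transportLeft (A : Operators T Q) (t : T) (a : List Bool) (x : Q) : Q :=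
  a.foldr (fun b x => A.signedOp t b x) x

/-- Operators of one type commute, so only the signed number of strands matters: minima and maxima
contribute two opposite signs, and crossings permute the strands. -/
theorem transportRight_eq (A : Operators T Q) (t : T) {w : List (Strip T)} {a b : List Bool}
    (hw : IsTangle a w b) (x : Q) : transportRight A t a x = transportRight A t b x := by
  induction w generalizing a with
  | nil => obtain rfl : a = b := hw; rfl
  | cons s w ih =>
    obtain ⟨rfl, hw⟩ := hw
    rw [← ih hw]
    have hp : ∀ y, transportRight A t s.piece.src y = transportRight A t s.piece.dst y := by
      intro y
      rcases s.piece with e | e | ⟨k, a, b⟩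
      · simp [transportRight, Piece.src, Piece.dst, A.signedOp_cancel_not]
      · simp [transportRight, Piece.src, Piece.dst, A.signedOp_cancel_not]
      · simp [transportRight, Piece.src, Piece.dst, A.signedOp_comm t t (!b)]
    simp only [transportRight, Strip.src, Strip.dst, List.foldl_append] at hp ⊢
    rw [hp]

theorem transportLeft_eq (A : Operators T Q) (t : T) {w : List (Strip T)} {a b : List Bool}
    (hw : IsTangle a w b) (x : Q) : transportLeft A t a x = transportLeft A t b x := by
  induction w generalizing a with
  | nil => obtain rfl : a = b := hw; rfl
  | cons s w ih =>
    obtain ⟨rfl, hw⟩ := hw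
    rw [← ih hw]
    have hp : ∀ y, transportLeft A t s.piece.src y = transportLeft A t s.piece.dst y := by
      intro y
      rcases s.piece with e | e | ⟨k, a, b⟩
      · simp [transportLeft, Piece.src, Piece.dst, A.signedOp_cancel_not]
      · simp [transportLeft, Piece.src, Piece.dst, A.signedOp_cancel_not]
      · simp [transportLeft, Piece.src, Piece.dst, A.signedOp_comm t t b]
    simp only [transportLeft, Strip.src, Strip.dst, List.foldr_append] at hp ⊢
    rw [hp]

end Transport

variable {Q : Type v} [Quandle Q] [Fintype Q] [DecidableEq Q]

/-- Operators are symmetries of all coloring rules: bijectivity reindexes the sum at a minimum and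
preserves the equation at a maximum, and `crossMap_signedOp` treats crossings. -/
theorem colorSum_map_signedOp (A : Operators T Q) (t : T) (e : Bool) (w : List (Strip T))
    (c : List Q) (f : List Q → ℕ) :
    colorSum A w (c.map (A.signedOp t e)) f =
      colorSum A w c fun d => f (d.map (A.signedOp t e)) := by
  have hpiece : ∀ (p : Piece T) (c : List Q) (f : List Q → ℕ),
      pieceSum A p (c.map (A.signedOp t e)) f =
        pieceSum A p c fun d => f (d.map (A.signedOp t e)) := by
    intro p c f
    match p, c with
    | .cup _, c =>
      exact (Equiv.sum_comp (A.signedOp t e) fun x => f (x :: x :: c.map (A.signedOp t e))).symm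
    | .cap _, [] => rfl
    | .cap _, [x] => rfl
    | .cap _, x :: y :: c => simp [pieceSum]
    | .cross _ _ _, [] => rfl
    | .cross _ _ _, [x] => rfl
    | .cross _ _ _, x :: y :: c => simp [pieceSum, crossMap_signedOp]
  induction w generalizing c with
  | nil => rfl
  | cons s w ih =>
    simp only [colorSum, stripSum, ← List.map_drop, hpiece, ← List.map_take, ← List.map_append, ih]

theorem colorSum_passRight (A : Operators T Q) (t : T) (e : Bool) {a : List Bool} {c : List Q}
    (hc : c.length = a.length) (x : Q) (f : List Q → ℕ) :
    colorSum A (passRight t e a) (x :: c) f =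
      f (c.map (A.signedOp t e) ++ [transportRight A t a x]) := by
  induction a generalizing c x f with
  | nil =>
    obtain rfl : c = [] := by simpa using hc
    rfl
  | cons b a ih =>
    obtain ⟨y, c, rfl⟩ := List.exists_cons_of_length_eq_add_one hc
    have hc' : c.length = a.length := by simpa using hc
    have h := colorSum_pad A (l := [b]) (r := []) (L := [A.signedOp t e y]) (R := [])
      (isTangle_passRight t e a) rfl (c := A.signedOp t (!b) x :: c) (by simp [hc']) f
    simp only [List.append_nil] at h
    exact h.trans (ih hc' _ _)

theorem colorSum_passLeft (A : Operators T Q) (t : T) (e : Bool) {a : List Bool} {c : List Q}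
    (hc : c.length = a.length) (x : Q) (f : List Q → ℕ) :
    colorSum A (passLeft t e a) (c ++ [x]) f =
      f (transportLeft A t a x :: c.map (A.signedOp t (!e))) := by
  induction a generalizing c x f with
  | nil =>
    obtain rfl : c = [] := by simpa using hc
    rfl
  | cons b a ih =>
    obtain ⟨y, c, rfl⟩ := List.exists_cons_of_length_eq_add_one hc
    have hc' : c.length = a.length := by simpa using hc
    have h := fun g => colorSum_pad A (l := [b]) (r := []) (L := [y]) (R := [])
      (isTangle_passLeft t e a) rfl (c := c ++ [x]) (by simp [hc']) g
    simp only [List.append_nil] at h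
    rw [passLeft, colorSum_append]
    exact (h _).trans (ih hc' _ _)

/-- On one side the operator acts on the colors below `w`, on the other on those above `w`.
Equivariance identifies the two, and `transportRight_eq` the final colors of the moving strand. -/
theorem colorSum_acrossRight (A : Operators T Q) (t : T) (e : Bool) {a b : List Bool}
    {w : List (Strip T)} (hw : IsTangle a w b) {c : List Q} (hc : c.length = a.length) (x : Q)
    (f : List Q → ℕ) :
    colorSum A (passRight t e a ++ pad [] [e] w) (x :: c) f =
      colorSum A (pad [e] [] w ++ passRight t e b) (x :: c) f := by
  have h1 := colorSum_pad A (l := []) (r := [e]) (L := []) (R := [transportRight A t a x]) hw rfl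
    (c := c.map (A.signedOp t e)) (by simp [hc]) f
  have h2 := fun g => colorSum_pad A (l := [e]) (r := []) (L := [x]) (R := []) hw rfl hc g
  simp only [List.append_nil, List.nil_append, List.singleton_append] at h1 h2
  rw [colorSum_append, colorSum_append, colorSum_passRight A t e hc, h1, h2,
    colorSum_map_signedOp, transportRight_eq A t hw]
  exact colorSum_congr A hw hc fun d hd => (colorSum_passRight A t e hd x f).symm

theorem colorSum_acrossLeft (A : Operators T Q) (t : T) (e : Bool) {a b : List Bool}
    {w : List (Strip T)} (hw : IsTangle a w b) {c : List Q} (hc : c.length = a.length) (x : Q)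
    (f : List Q → ℕ) :
    colorSum A (passLeft t e a ++ pad [e] [] w) (c ++ [x]) f =
      colorSum A (pad [] [e] w ++ passLeft t e b) (c ++ [x]) f := by
  have h1 := colorSum_pad A (l := [e]) (r := []) (L := [transportLeft A t a x]) (R := []) hw rfl
    (c := c.map (A.signedOp t (!e))) (by simp [hc]) f
  have h2 := fun g => colorSum_pad A (l := []) (r := [e]) (L := []) (R := [x]) hw rfl hc g
  simp only [List.append_nil, List.nil_append, List.singleton_append] at h1 h2
  rw [colorSum_append, colorSum_append, colorSum_passLeft A t e hc, h1, h2,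
    colorSum_map_signedOp, transportLeft_eq A t hw]
  exact colorSum_congr A hw hc fun d hd => (colorSum_passLeft A t e hd x f).symm

/-! ### Invariance of the number of colorings -/

/-- `x` and `y` are tangle diagrams with the same end points `a` and `b`, and colorings by `A` do not
distinguish them. -/
def ColorEquivalent (A : Operators T Q) (a b : List Bool) (x y : List (Strip T)) : Prop :=
  IsTangle a x b ∧ IsTangle a y b ∧
    ∀ c : List Q, c.length = a.length → ∀ f, colorSum A x c f = colorSum A y c f

theorem PlanarIsotopy.colorEquivalent {x y : List (Strip T)} (h : PlanarIsotopy x y)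
    (A : Operators T Q) : ∃ a b, ColorEquivalent A a b x y := by
  rcases h with ⟨g, h, m⟩ | e | e | ⟨k, e, c⟩ | ⟨k, e, c⟩
  · exact ⟨g.src ++ m ++ h.src, g.dst ++ m ++ h.dst, by simp [IsTangle, Strip.src, Strip.dst],
      by simp [IsTangle, Strip.src, Strip.dst], fun c hc f => colorSum_exchange A g h m hc f⟩
  · refine ⟨[e], [e], by simp [IsTangle, Strip.src, Strip.dst, Piece.src, Piece.dst], rfl, ?_⟩
    intro c hc f
    obtain ⟨x, rfl⟩ := List.length_eq_one_iff.mp hc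
    simp [colorSum, stripSum, pieceSum]
  · refine ⟨[e], [e], by simp [IsTangle, Strip.src, Strip.dst, Piece.src, Piece.dst], rfl, ?_⟩
    intro c hc f
    obtain ⟨x, rfl⟩ := List.length_eq_one_iff.mp hc
    simp [colorSum, stripSum, pieceSum]
  · refine ⟨[e, c, !e], [c], ⟨rfl, rfl, rfl⟩, ⟨rfl, rfl, rfl⟩, fun d hd f => ?_⟩
    obtain ⟨x, y, z, rfl⟩ := List.length_eq_three.mp hd
    exact colorSum_cross_cap A k e c x y z f
  · refine ⟨[c], [e, c, !e], ⟨rfl, rfl, rfl⟩, ⟨rfl, rfl, rfl⟩, fun d hd f => ?_⟩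
    obtain ⟨x, rfl⟩ := List.length_eq_one_iff.mp hd
    exact colorSum_cup_cross A k e c x f

theorem colorEquivalent_kinkRight (A : Operators T Q) (k : CrossingKind T) (e : Bool) :
    ColorEquivalent A [e] [e] (kinkRight k e) [] := by
  refine ⟨⟨rfl, rfl, rfl, rfl⟩, rfl, fun c hc f => ?_⟩
  obtain ⟨x, rfl⟩ := List.length_eq_one_iff.mp hc
  exact colorSum_kinkRight A k e x f

theorem colorEquivalent_kinkLeft (A : Operators T Q) (k : CrossingKind T) (e : Bool) :
    ColorEquivalent A [e] [e] (kinkLeft k e) [] := by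
  refine ⟨by simp [kinkLeft, IsTangle, Strip.src, Strip.dst, Piece.src, Piece.dst], rfl,
    fun c hc f => ?_⟩
  obtain ⟨x, rfl⟩ := List.length_eq_one_iff.mp hc
  exact colorSum_kinkLeft A k e x f

theorem ClassicalReidemeister.colorEquivalent {x y : List (Strip T)}
    (h : ClassicalReidemeister x y) (A : Operators T Q) :
    ∃ a b, ColorEquivalent A a b x y := by
  rcases h with ⟨o, e⟩ | ⟨o, e⟩ | ⟨o, a, b⟩ | ⟨o₁, o₂, o₃, a, b, c, ho⟩
  · exact ⟨[e], [e], colorEquivalent_kinkRight A _ e⟩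
  · exact ⟨[e], [e], colorEquivalent_kinkLeft A _ e⟩
  · refine ⟨[a, b], [a, b], ⟨rfl, rfl, rfl⟩, rfl, fun c hc f => ?_⟩
    obtain ⟨x, y, rfl⟩ := List.length_eq_two.mp hc
    exact colorSum_reidemeister_two A o a b x y f
  · refine ⟨[a, b, c], [c, b, a], ⟨rfl, rfl, rfl, rfl⟩, ⟨rfl, rfl, rfl, rfl⟩, fun d hd f => ?_⟩
    obtain ⟨x, y, z, rfl⟩ := List.length_eq_three.mp hd
    exact colorSum_reidemeister_three A o₁ o₂ o₃ a b c ho x y z f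

theorem Detour.colorEquivalent {x y : List (Strip T)} (h : Detour x y) (A : Operators T Q) :
    ∃ a b, ColorEquivalent A a b x y := by
  rcases h with ⟨t, e, a, b, w, hw⟩ | ⟨t, e, a, b, w, hw⟩ | ⟨t, e⟩ | ⟨t, e⟩
  · refine ⟨e :: a, b ++ [e], (isTangle_passRight t e a).append (by simpa using hw.pad [] [e]),
      (by simpa using hw.pad [e] [] : IsTangle (e :: a) _ (e :: b)).append
        (isTangle_passRight t e b), fun c hc f => ?_⟩
    obtain ⟨x, c, rfl⟩ := List.exists_cons_of_length_eq_add_one hc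
    exact colorSum_acrossRight A t e hw (by simpa using hc) x f
  · refine ⟨a ++ [e], e :: b, (isTangle_passLeft t e a).append (by simpa using hw.pad [e] []),
      (by simpa using hw.pad [] [e] : IsTangle (a ++ [e]) _ (b ++ [e])).append
        (isTangle_passLeft t e b), fun c hc f => ?_⟩
    have hc0 : c ≠ [] := by
      rintro rfl
      simp at hc
    rw [← List.dropLast_append_getLast hc0]
    exact colorSum_acrossLeft A t e hw (by simp [hc]) _ f
  · exact ⟨[e], [e], colorEquivalent_kinkRight A _ e⟩
  · exact ⟨[e], [e], colorEquivalent_kinkLeft A _ e⟩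

theorem colorSum_replace (A : Operators T Q) {a b l r : List Bool}
    {x y below above : List (Strip T)} (h : ColorEquivalent A a b x y)
    (hx : IsTangle [] (below ++ pad l r x ++ above) [])
    (hy : IsTangle [] (below ++ pad l r y ++ above) []) (f : List Q → ℕ) :
    colorSum A (below ++ pad l r x ++ above) [] f =
      colorSum A (below ++ pad l r y ++ above) [] f := by
  obtain ⟨hxa, hya, heq⟩ := h
  have hstart : ∀ {z : List (Strip T)} {a₀ c : List Bool}, z ≠ [] → IsTangle a z b →
      IsTangle a₀ (pad l r z ++ above) c → a₀ = l ++ a ++ r := by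
    intro z a₀ c hz h h'
    obtain ⟨s, z, rfl⟩ := List.exists_cons_of_ne_nil hz
    rw [← h'.1, ← h.1]
    simp [Strip.src]
  rw [List.append_assoc] at hx hy
  obtain ⟨a₀, hbelow, hx⟩ := hx.exists_of_append
  obtain ⟨a₁, hbelow', hy⟩ := hy.exists_of_append
  obtain rfl := hbelow.unique hbelow'
  -- If both parts are empty, nothing ties the row at the cut to `l ++ a ++ r`, but the diagrams
  -- coincide. Otherwise the first strip of a nonempty part determines that row.
  by_cases hnil : x = [] ∧ y = []
  · rw [hnil.1, hnil.2]
  obtain rfl : a₀ = l ++ a ++ r := by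
    by_cases h : x = []
    · exact hstart (fun h' => hnil ⟨h, h'⟩) hya hy
    · exact hstart h hxa hx
  simp only [colorSum_append]
  refine colorSum_congr A hbelow rfl fun d hd => ?_
  obtain ⟨L, c, R, hL, hc, rfl⟩ : ∃ L c R : List Q, L.length = l.length ∧
      c.length = a.length ∧ d = L ++ c ++ R := by
    simp only [List.length_append] at hd
    exact ⟨d.take l.length, (d.drop l.length).take a.length, (d.drop l.length).drop a.length,
      by simp; omega, by simp; omega, by simp⟩
  rw [colorSum_pad A hxa hL hc, colorSum_pad A hya hL hc, heq c hc]

theorem LinkDiagram.Step.colorSum_eq {D E : LinkDiagram T} (h : D.Step E) (A : Operators T Q)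
    (f : List Q → ℕ) : colorSum A D.strips [] f = colorSum A E.strips [] f := by
  obtain ⟨below, above, x, y, l, r, hmove, hD, hE⟩ := h
  obtain ⟨a, b, hab⟩ : ∃ a b, ColorEquivalent A a b x y := by
    rcases hmove with h | h | h
    · exact h.colorEquivalent A
    · exact h.colorEquivalent A
    · exact h.colorEquivalent A
  have hx := D.closed
  have hy := E.closed
  rw [hD] at hx ⊢
  rw [hE] at hy ⊢
  exact colorSum_replace A hab hx hy f

/-- The number of colorings by a finite operator quandle is an invariant of multi-virtual links. -/
theorem LinkDiagram.Equivalent.col_eq {D E : LinkDiagram T} (h : D.Equivalent E)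
    (A : Operators T Q) : col D A = col E A := by
  induction h with
  | rel D E h => rw [col_eq_colorSum, col_eq_colorSum, h.colorSum_eq A]
  | refl D => rfl
  | symm D E _ ih => exact ih.symm
  | trans D E F _ _ ih₁ ih₂ => exact ih₁.trans ih₂

end

/-! ### The colorings of `K(n)` -/

section KnotK

variable {Q : Type v} [Quandle Q] [Fintype Q] [DecidableEq Q]

/-- The crossing of type `α` merely swaps the strands; the one of type `β` swaps them back, applying
its operator to one and the inverse to the other. -/
theorem colorSum_twists (A : Operators T Q) {α β : T} (hα : A.op α = 1) (n : ℕ) (u v x y : Q)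
    (f : List Q → ℕ) :
    colorSum A (List.replicate n
        [(⟨[false], .cross (.virt α) true true, [false]⟩ : Strip T),
          ⟨[false], .cross (.virt β) true true, [false]⟩]).flatten [u, x, y, v] f =
      f [u, (A.op β ^ n) x, (A.op β ^ n).symm y, v] := by
  induction n generalizing x y with
  | zero => rfl
  | succ n ih =>
    rw [List.replicate_succ, List.flatten_cons, colorSum_append]
    have h : ∀ g : List Q → ℕ, colorSum A
        [(⟨[false], .cross (.virt α) true true, [false]⟩ : Strip T),
          ⟨[false], .cross (.virt β) true true, [false]⟩] [u, x, y, v] g =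
        g [u, A.op β x, (A.op β).symm y, v] := by
      intro g
      have h1 : (1 : Equiv.Perm Q).symm = 1 := rfl
      simp [colorSum, stripSum, pieceSum, crossMap, Operators.signedOp, hα, h1]
    have h1 : (A.op β ^ (n + 1)) x = (A.op β ^ n) (A.op β x) := by rw [pow_succ]; rfl
    have h2 : (A.op β ^ (n + 1)).symm y = (A.op β ^ n).symm ((A.op β).symm y) := by
      rw [pow_succ']; rfl
    rw [h, ih, h1, h2]

theorem colorSum_knotK (A : Operators T Q) {α β : T} (hα : A.op α = 1) (n : ℕ) :
    (colorSum A (knotK α β n).strips [] fun _ => 1) =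
      Fintype.card {x : Q // Shelf.act ((A.op β ^ n) x) x = x} := by
  have hend : ∀ u x y v : Q, colorSum A
      ([(⟨[false], .cross (.classical true) true true, [false]⟩ : Strip T)] ++
        [⟨[], .cap false, [true, false]⟩, ⟨[], .cap true, []⟩]) [u, x, y, v] (fun _ => 1) =
      if u = Shelf.act x y then if x = v then 1 else 0 else 0 := by
    intro u x y v
    simp [colorSum, stripSum, pieceSum, crossMap, signedAct]
  have hstart : ∀ g : List Q → ℕ, colorSum A
      [(⟨[], .cup false, []⟩ : Strip T), ⟨[false, true], .cup true, []⟩] [] g =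
        ∑ x, ∑ y, g [x, x, y, y] := fun _ => rfl
  change colorSum A (knotKStrips α β n) [] _ = _
  rw [knotKStrips, List.append_assoc, colorSum_append, colorSum_append, hstart,
    Fintype.card_subtype, Finset.card_filter]
  simp only [colorSum_twists A hα, hend]
  refine Finset.sum_congr rfl fun x _ => ?_
  -- Closing on the right forces `y` to be the color of the overpass, `B^n x` with `B = A.op β`. The
  -- underpass then enters the classical crossing with color `x`, and closing on the left gives the
  -- fixed point equation.
  refine (Fintype.sum_eq_single ((A.op β ^ n) x) fun y hy => ?_).trans ?_
  · simp [hy.symm]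
  · simp [eq_comm]

/-- Without classical crossings only the operators matter, so a bijection intertwining them
transports colorings even if it is no quandle morphism. -/
theorem colorSum_eq_of_not_classical {Q' : Type*} [Quandle Q'] [Fintype Q'] [DecidableEq Q']
    (A : Operators T Q) (B : Operators T Q') (φ : Q ≃ Q')
    (hφ : ∀ t x, φ (A.op t x) = B.op t (φ x)) {w : List (Strip T)}
    (hw : ∀ s ∈ w, s.isClassical = false) (c : List Q) (f : List Q' → ℕ) :
    (colorSum A w c fun d => f (d.map φ)) = colorSum B w (c.map φ) f := by
  have hsymm : ∀ t x, φ ((A.op t).symm x) = (B.op t).symm (φ x) := fun t x => by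
    rw [Equiv.eq_symm_apply, ← hφ, Equiv.apply_symm_apply]
  have hsigned : ∀ t e x, φ (A.signedOp t e x) = B.signedOp t e (φ x) := fun t e x => by
    cases e
    · exact hsymm t x
    · exact hφ t x
  have hpiece : ∀ (s : Strip T), s.isClassical = false → ∀ (c : List Q) (f : List Q' → ℕ),
      (pieceSum A s.piece c fun d => f (d.map φ)) = pieceSum B s.piece (c.map φ) f := by
    intro s hs c f
    obtain ⟨l, p, r⟩ := s
    match p, c with
    | .cup _, c => exact Equiv.sum_comp φ fun x => f (x :: x :: c.map φ)
    | .cap _, [] => rfl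
    | .cap _, [x] => rfl
    | .cap _, x :: y :: c => simp [pieceSum]
    | .cross _ _ _, [] => rfl
    | .cross _ _ _, [x] => rfl
    | .cross (.virt t) _ _, x :: y :: c => simp [pieceSum, crossMap, hsigned]
    | .cross (.classical _) _ _, x :: y :: c => simp [Strip.isClassical] at hs
  induction w generalizing c with
  | nil => rfl
  | cons s w ih =>
    have ih' := ih fun s' hs' => hw s' (List.mem_cons_of_mem _ hs')
    have hs := hpiece s (hw s List.mem_cons_self)
    simp only [colorSum, stripSum, ← List.map_drop, ← List.map_take, ← hs, ih', List.map_append]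

end KnotK

/-! ### Dihedral and trivial quandles on `ℤ/m` -/

instance (m : ℕ) [NeZero m] : Fintype (Quandle.Dihedral m) := inferInstanceAs (Fintype (ZMod m))

instance (m : ℕ) : DecidableEq (Quandle.Dihedral m) := inferInstanceAs (DecidableEq (ZMod m))

theorem dihedralShift_pow (m n : ℕ) :
    dihedralShift m ^ n = (Equiv.addRight (n : ZMod m) : Equiv.Perm (ZMod m)) := by
  have h : (Equiv.addRight (1 : ZMod m) ^ n : Equiv.Perm (ZMod m)) =
      Equiv.addRight (n : ZMod m) := by
    simp
  exact h

/-- The equation `2 (x + n) - x = x` does not depend on `x`, so either every color or none solves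
it. -/
theorem col_knotK_dihedral {α β : T} (hαβ : α ≠ β) (m n : ℕ) [NeZero m] :
    col (knotK α β n) (dihedralOperators β m) = if m ∣ 2 * n then (m : ℕ∞) else 0 := by
  have hα : (dihedralOperators β m).op α = 1 := if_neg hαβ
  have hβ : (dihedralOperators β m).op β = dihedralShift m := if_pos rfl
  have hcond : ∀ x : Quandle.Dihedral m,
      Shelf.act (((dihedralOperators β m).op β ^ n) x) x = x ↔ m ∣ 2 * n := by
    intro x
    have key : ∀ x : ZMod m, 2 * (x + n) - x = x ↔ m ∣ 2 * n := by
      intro x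
      rw [← ZMod.natCast_eq_zero_iff]
      push_cast
      constructor <;> intro h <;> linear_combination h
    rw [hβ, dihedralShift_pow]
    exact key x
  rw [col_eq_colorSum, colorSum_knotK _ hα]
  simp only [hcond]
  split_ifs with h
  · simp only [h]
    rw [Fintype.card_congr (Equiv.subtypeUnivEquiv fun _ => trivial)]
    exact congrArg _ (ZMod.card m)
  · simp [h]

/-- The trivial quandle on a type: `x * y = x`. -/
def TrivialQuandle (X : Type v) : Type v := X

instance (X : Type v) : Quandle (TrivialQuandle X) where
  act _ y := y
  self_distrib := rfl
  invAct _ y := y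
  left_inv _ _ := rfl
  right_inv _ _ := rfl
  fix := rfl

/-- The operators of `dihedralOperators` on the trivial quandle on `ℤ/m`. -/
noncomputable def trivialOperators (β : T) (m : ℕ) :
    Operators T (TrivialQuandle (ZMod m)) where
  op := (dihedralOperators β m).op
  map_act _ _ _ := rfl
  comm := (dihedralOperators β m).comm

instance (m : ℕ) [NeZero m] : Fintype (TrivialQuandle (ZMod m)) :=
  inferInstanceAs (Fintype (ZMod m))

instance (m : ℕ) : DecidableEq (TrivialQuandle (ZMod m)) := inferInstanceAs (DecidableEq (ZMod m))

theorem col_knotK_trivial {α β : T} (hαβ : α ≠ β) (m n : ℕ) [NeZero m] :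
    col (knotK α β n) (trivialOperators β m) = m := by
  have hα : (trivialOperators β m).op α = 1 := if_neg hαβ
  have hact : ∀ x : TrivialQuandle (ZMod m),
      Shelf.act (((trivialOperators β m).op β ^ n) x) x = x := fun _ => rfl
  rw [col_eq_colorSum, colorSum_knotK _ hα, Fintype.card_congr (Equiv.subtypeUnivEquiv hact)]
  exact congrArg _ (ZMod.card m)

/-! ### The classical crossing number of `K(n)` -/

theorem LinkDiagram.col_dihedral_eq_col_trivial {D : LinkDiagram T} (hD : D.classicalCrossings = 0)
    (β : T) (m : ℕ) [NeZero m] :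
    col D (dihedralOperators β m) = col D (trivialOperators β m) := by
  have hw : ∀ s ∈ D.strips, s.isClassical = false := by
    simpa [LinkDiagram.classicalCrossings, List.countP_eq_zero] using hD
  rw [col_eq_colorSum, col_eq_colorSum]
  exact congrArg _ (colorSum_eq_of_not_classical (dihedralOperators β m) (trivialOperators β m)
    (Equiv.refl (ZMod m)) (fun _ _ => rfl) hw [] fun _ => 1)

theorem classicalCrossings_knotK (α β : T) (n : ℕ) : (knotK α β n).classicalCrossings = 1 := by
  have h : ((List.replicate n
      [(⟨[false], .cross (.virt α) true true, [false]⟩ : Strip T),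
        ⟨[false], .cross (.virt β) true true, [false]⟩]).flatten).countP Strip.isClassical = 0 := by
    rw [List.countP_eq_zero]
    intro s hs
    simp only [List.mem_flatten, List.mem_replicate] at hs
    obtain ⟨l, ⟨-, rfl⟩, hs⟩ := hs
    simp only [List.mem_cons, List.not_mem_nil, or_false] at hs
    rcases hs with rfl | rfl <;> simp [Strip.isClassical]
  change (knotKStrips α β n).countP Strip.isClassical = 1
  simp only [knotKStrips, List.countP_append, h]
  rfl

theorem classicalCrossingNumber_knotK {α β : T} (hαβ : α ≠ β) {n : ℕ} (hn : Odd n) :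
    (knotK α β n).link.classicalCrossingNumber = 1 := by
  refine le_antisymm (Nat.sInf_le ⟨_, rfl, classicalCrossings_knotK α β n⟩) ?_
  refine le_csInf ⟨_, _, rfl, classicalCrossings_knotK α β n⟩ ?_
  rintro k ⟨D, hD, rfl⟩
  by_contra hlt
  have h0 : D.classicalCrossings = 0 := by omega
  have hequiv : D.Equivalent (knotK α β n) := Quotient.exact hD
  -- Modulus 4 serves all odd `n` at once: `4 ∤ 2n`, so the dihedral count is 0 while the trivial
  -- one is 4.
  have h := D.col_dihedral_eq_col_trivial h0 β 4
  rw [hequiv.col_eq, hequiv.col_eq, col_knotK_trivial hαβ, col_knotK_dihedral hαβ,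
    if_neg (by obtain ⟨k, rfl⟩ := hn; omega)] at h
  exact absurd h (by norm_num)

/-! ### `K(n)` is a knot -/

/-- Connectivity ignores the kind of a crossing, so all `2n + 1` crossing strips are treated alike;
the offset 2 skips the two minima. -/
theorem knotKStrips_getElem? (α β : T) (n i : ℕ) (hi : i < 2 * n + 1) :
    ∃ k, (knotKStrips α β n)[i + 2]? = some ⟨[false], .cross k true true, [false]⟩ := by
  set tw := (List.replicate n
      [(⟨[false], .cross (.virt α) true true, [false]⟩ : Strip T),
        ⟨[false], .cross (.virt β) true true, [false]⟩]).flatten with htw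
  have hlen : tw.length = 2 * n := by simp [htw, mul_comm]
  have hstrips : knotKStrips α β n = [⟨[], .cup false, []⟩, ⟨[false, true], .cup true, []⟩] ++
      ((tw ++ [⟨[false], .cross (.classical true) true true, [false]⟩]) ++
      [⟨[], .cap false, [true, false]⟩, ⟨[], .cap true, []⟩]) := by
    simp [knotKStrips, htw]
  have hi' : i < (tw ++ [(⟨[false], .cross (.classical true) true true, [false]⟩ :
      Strip T)]).length := by simp [hlen, hi]
  rw [hstrips, List.getElem?_append_right (by simp)]
  simp only [List.length_cons, List.length_nil, Nat.zero_add, Nat.reduceAdd, Nat.add_sub_cancel]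
  rw [List.getElem?_append_left hi', List.getElem?_eq_getElem hi']
  have hmem := List.getElem_mem hi'
  generalize (tw ++ _)[i] = s at hmem
  simp only [htw, List.mem_append, List.mem_flatten, List.mem_replicate] at hmem
  obtain ⟨l, ⟨-, rfl⟩, h⟩ | h := hmem
  · simp only [List.mem_cons, List.not_mem_nil, or_false] at h
    rcases h with rfl | rfl <;> exact ⟨_, rfl⟩
  · obtain rfl := List.mem_singleton.mp h
    exact ⟨_, rfl⟩

/-- An odd number `2n + 1` of crossings interchanges the two inner strands, so the closing arcs join
everything into one loop. -/
theorem isKnot_knotK (α β : T) (n : ℕ) : (knotK α β n).IsKnot := by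
  set D := knotK α β n with hD
  have hlen : (knotKStrips α β n).length = 2 * n + 5 := by
    simp [knotKStrips, mul_comm]
  have hs0 : D.strips[0]? = some ⟨[], .cup false, []⟩ := rfl
  have hs1 : D.strips[1]? = some ⟨[false, true], .cup true, []⟩ := rfl
  have hsx : ∀ i < 2 * n + 1,
      ∃ k, D.strips[i + 2]? = some ⟨[false], .cross k true true, [false]⟩ :=
    knotKStrips_getElem? α β n
  have hs3 : D.strips[2 * n + 3]? = some ⟨[], .cap false, [true, false]⟩ := by
    change (knotKStrips α β n)[2 * n + 3]? = _
    rw [knotKStrips, List.getElem?_append_right (by simp; omega)]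
    simp [mul_comm]
  have hs4 : D.strips[2 * n + 4]? = some ⟨[], .cap true, []⟩ := by
    change (knotKStrips α β n)[2 * n + 4]? = _
    rw [knotKStrips, List.getElem?_append_right (by simp; omega)]
    simp [mul_comm]
  let R : ℕ × ℕ → ℕ × ℕ → Prop := Relation.EqvGen D.Joined
  have rel : ∀ {x y}, D.Joined x y → R x y := fun h => .rel _ _ h
  have symm : ∀ {x y}, R x y → R y x := fun h => .symm _ _ h
  have trans : ∀ {x y z}, R x y → R y z → R x z := fun h h' => .trans _ _ _ h h'
  have houter : ∀ j ≤ 2 * n + 1, R (2, 0) (j + 2, 0) ∧ R (2, 3) (j + 2, 3) := by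
    intro j
    induction j with
    | zero => exact fun _ => ⟨.refl _, .refl _⟩
    | succ j ih =>
      intro hj
      obtain ⟨k, hk⟩ := hsx j (by omega)
      obtain ⟨h1, h2⟩ := ih (by omega)
      exact ⟨trans h1 (rel (.left (j + 2) 0 _ hk (by simp))),
        trans h2 (rel (.right (j + 2) 0 _ hk (by simp)))⟩
  -- Each crossing swaps the inner positions 1 and 2, so the parity of `j` decides where they have
  -- gone.
  have hinner : ∀ j ≤ 2 * n + 1,
      (Even j → R (2, 1) (j + 2, 1) ∧ R (2, 2) (j + 2, 2)) ∧
      (¬ Even j → R (2, 1) (j + 2, 2) ∧ R (2, 2) (j + 2, 1)) := by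
    intro j
    induction j with
    | zero => exact fun _ => ⟨fun _ => ⟨.refl _, .refl _⟩, fun h => absurd Even.zero h⟩
    | succ j ih =>
      intro hj
      obtain ⟨k, hk⟩ := hsx j (by omega)
      obtain ⟨ih1, ih2⟩ := ih (by omega)
      have up : R (j + 2, 1) (j + 3, 2) := rel (.rising (j + 2) _ _ _ _ hk rfl)
      have down : R (j + 2, 2) (j + 3, 1) := rel (.falling (j + 2) _ _ _ _ hk rfl)
      rw [Nat.even_add_one, not_not]
      exact ⟨fun h => ⟨trans (ih2 h).1 down, trans (ih2 h).2 up⟩,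
        fun h => ⟨trans (ih1 h).1 up, trans (ih1 h).2 down⟩⟩
  have hodd : ¬ Even (2 * n + 1) := by simp
  obtain ⟨ho1, ho2⟩ := houter _ le_rfl
  obtain ⟨hi1, hi2⟩ := (hinner _ le_rfl).2 hodd
  have b1 : R (1, 0) (1, 1) := rel (.cup 0 _ _ hs0 rfl)
  have b2 : R (2, 2) (2, 3) := rel (.cup 1 _ _ hs1 rfl)
  have b3 : R (1, 0) (2, 0) := rel (.left 1 0 _ hs1 (by simp))
  have b4 : R (1, 1) (2, 1) := rel (.left 1 1 _ hs1 (by simp))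
  have t1 : R (2 * n + 3, 0) (2 * n + 3, 1) := rel (.cap _ _ _ hs3 rfl)
  have t2 : R (2 * n + 4, 0) (2 * n + 4, 1) := rel (.cap _ _ _ hs4 rfl)
  have t3 : R (2 * n + 3, 2) (2 * n + 4, 0) := rel (.right _ 0 _ hs3 (by simp))
  have t4 : R (2 * n + 3, 3) (2 * n + 4, 1) := rel (.right _ 1 _ hs3 (by simp))
  have p20 : R (2, 0) (1, 0) := symm b3
  have p21 : R (2, 1) (1, 0) := symm (trans b1 b4)
  have p22 : R (2, 2) (1, 0) := trans hi2 (trans (symm t1) (trans (symm ho1) p20))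
  have p23 : R (2, 3) (1, 0) := trans (symm b2) p22
  have q0 : R (2 * n + 4, 0) (1, 0) := symm (trans (symm p21) (trans hi1 t3))
  have main : ∀ x, D.IsPoint x → R x (1, 0) := by
    rintro ⟨i, j⟩ ⟨s, hs, hj⟩
    simp only at hs hj
    have hi : i < 2 * n + 5 := by
      rw [← hlen]
      exact (List.getElem?_eq_some_iff.mp hs).1
    have hrow : ∀ k, k ≤ 2 * n + 1 → ∀ j < 4, R (k + 2, j) (1, 0) := by
      intro k hk j hj
      obtain ⟨h0, h3⟩ := houter k hk
      obtain ⟨he, hne⟩ := hinner k hk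
      interval_cases j
      · exact trans (symm h0) p20
      · by_cases h : Even k
        · exact trans (symm (he h).1) p21
        · exact trans (symm (hne h).2) p22
      · by_cases h : Even k
        · exact trans (symm (he h).2) p22
        · exact trans (symm (hne h).1) p21
      · exact trans (symm h3) p23
    -- Row 0 is empty, rows 1 and `2n + 4` have two points, and the rows between them have four.
    rcases i with _ | _ | k
    · obtain rfl := Option.some.inj (hs0.symm.trans hs)
      simp [Strip.src, Piece.src] at hj
    · obtain rfl := Option.some.inj (hs1.symm.trans hs)
      simp only [Strip.src, Piece.src, List.append_nil, List.length_cons, List.length_nil] at hj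
      interval_cases j
      · exact .refl _
      · exact symm b1
    · rcases Nat.lt_or_ge k (2 * n + 1) with hk | hk
      · obtain ⟨_, hk'⟩ := hsx k hk
        obtain rfl := Option.some.inj (hk'.symm.trans hs)
        exact hrow k hk.le j hj
      · obtain rfl | rfl : k = 2 * n + 1 ∨ k = 2 * n + 2 := by omega
        · obtain rfl := Option.some.inj (hs3.symm.trans hs)
          exact hrow _ le_rfl j hj
        · obtain rfl := Option.some.inj (hs4.symm.trans hs)
          simp only [Strip.src, Piece.src, List.append_nil, List.nil_append, List.length_cons,
            List.length_nil] at hj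
          interval_cases j
          · exact q0
          · exact trans (symm t2) q0
  exact ⟨⟨(1, 0), _, hs1, by simp [Strip.src]⟩,
    fun x y hx hy => trans (main x hx) (symm (main y hy))⟩

/-! ### Nonequivalence and the infinite family -/

theorem not_equivalent_knotK {α β : T} (hαβ : α ≠ β) {p q : ℕ} (hp : p ≠ 0) (hpq : ¬ p ∣ 2 * q) :
    ¬ (knotK α β p).Equivalent (knotK α β q) := by
  have : NeZero p := ⟨hp⟩
  intro h
  have h' := h.col_eq (dihedralOperators β p)
  rw [col_knotK_dihedral hαβ, col_knotK_dihedral hαβ, if_pos (Dvd.intro_left 2 rfl),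
    if_neg hpq] at h'
  exact hp (by exact_mod_cast h')

theorem not_dvd_two_mul_of_prime {p q : ℕ} (hp : p.Prime) (hodd : Odd p) (hq : q.Prime)
    (hpq : p ≠ q) : ¬ p ∣ 2 * q := by
  rw [hp.dvd_mul, Nat.prime_dvd_prime_iff_eq hp Nat.prime_two, Nat.prime_dvd_prime_iff_eq hp hq]
  rintro (rfl | h)
  · exact absurd hodd (by decide)
  · exact hpq h

theorem infinite_odd_primes : {p : ℕ | p.Prime ∧ Odd p}.Infinite := by
  refine (Nat.infinite_setOfPred_prime.sdiff (Set.finite_singleton 2)).mono ?_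
  rintro p ⟨hp, h2⟩
  exact ⟨hp, hp.odd_of_ne_two h2⟩

end MultiVirtual

open MultiVirtual in
theorem mainTheorem7 {T : Type*} (α β : T) (hαβ : α ≠ β) :
    (∀ p q : ℕ, p.Prime → Odd p → q.Prime → Odd q → p < q →
      ¬ (MultiVirtual.knotK α β p).Equivalent (MultiVirtual.knotK α β q) ∧
      (∀ D : MultiVirtual.LinkDiagram T, D.Equivalent (MultiVirtual.knotK α β p) →
        MultiVirtual.col D (MultiVirtual.dihedralOperators β p) = p) ∧
      (∀ D : MultiVirtual.LinkDiagram T, D.Equivalent (MultiVirtual.knotK α β q) →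
        MultiVirtual.col D (MultiVirtual.dihedralOperators β p) = 0)) ∧
    (∀ p : ℕ, p.Prime → Odd p →
      (MultiVirtual.knotK α β p).IsKnot ∧
      (MultiVirtual.knotK α β p).classicalCrossings = 1 ∧
      (MultiVirtual.knotK α β p).link.classicalCrossingNumber = 1) ∧
    {L : MultiVirtual.Link T | L.IsKnot ∧ L.classicalCrossingNumber = 1}.Infinite := by
  refine ⟨fun p q hp hpo hq _ hpq => ?_, fun p _ hpo => ⟨isKnot_knotK α β p,
    classicalCrossings_knotK α β p, classicalCrossingNumber_knotK hαβ hpo⟩, ?_⟩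
  · have : NeZero p := ⟨hp.ne_zero⟩
    have hndvd := not_dvd_two_mul_of_prime hp hpo hq hpq.ne
    refine ⟨not_equivalent_knotK hαβ hp.ne_zero hndvd, fun D hD => ?_, fun D hD => ?_⟩
    · rw [hD.col_eq, col_knotK_dihedral hαβ, if_pos (Dvd.intro_left 2 rfl)]
    · rw [hD.col_eq, col_knotK_dihedral hαβ, if_neg hndvd]
  -- Distinct odd primes give distinct links, so the infinite set of odd primes embeds into the set
  -- of links in question.
  · refine Set.infinite_of_injOn_mapsTo (f := fun p => (knotK α β p).link) ?_ ?_
      infinite_odd_primes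
    · rintro p ⟨hp, hpo⟩ q ⟨hq, -⟩ h
      by_contra hpq
      exact not_equivalent_knotK hαβ hp.ne_zero (not_dvd_two_mul_of_prime hp hpo hq hpq)
        (Quotient.exact h)
    · rintro p ⟨-, hpo⟩
      exact ⟨⟨_, rfl, isKnot_knotK α β p⟩, classicalCrossingNumber_knotK hαβ hpo⟩
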